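/- Let $n,m\ge 0$ be integers, $Q\in\mathbb R^{n\times n}$ symmetric positive semidefinite and $R\in\mathbb R^{m\times m}$ symmetric positive definite. **LQR.** For $A\in\mathbb R^{n\times n}$, $B\in\mathbb R^{n\times m}$, $x_0\in\mathbb R^n$ and an input $u:\mathbb Z_+\to\mathbb R^m$, let $x$ be the solution of $x(t+1)=Ax(t)+Bu(t)$, $x(0)=x_0$, and $J(x_0,u)=\sum_{t=0}^\infty \big(x(t)^\top Qx(t)+u(t)^\top Ru(t)\big)\in[0,\infty]$. The optimal LQR problem is *solvable* for $(A,B,Q,R)$ if for every $x_0$ there is an input $u^*$ with $J(x_0,u^*)<\infty$ and $x(t)\to0$ that minimizes $J(x_0,\cdot)$ among all inputs for which $x(t)\to 0$. In that case the matrix $$K=-(R+B^\top P^+B)^{-1}B^\top P^+A \qquad(1)$$ is called the *optimal feedback gain* for $(A,B,Q,R)$, where $P^+$ is the largest (in the Loewner order) real symmetric solution of the Riccati equation $$P=A^\top PA-A^\top PB(R+B^\top PB)^{-1}B^\top PA+Q \qquad(2)$$ (the invertibility of $R+B^\top PB$ being part of the notion of a solution). **Data.** Exact input-state data $(U_-,X)$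 are measured on finitely many finite time intervals (a single interval $\{0,\dots,T\}$ being a special case) from an unknown true system $x(t+1)=A_sx(t)+B_su(t)$ with $n$ states and $m$ inputs. Let $U_-$ and $X_-$ collect as columns the inputs $u(t)$ and states $x(t)$ at all times $t$ except the final one of each interval, and let $X_+$ collect the corresponding states $x(t+1)$. The set of systems consistent with the data is $$\Sigma_{\mathcal D}=\left\{(A,B)\in\mathbb R^{n\times n}\times\mathbb R^{n\times m}\;\middle|\;X_+=\begin{bmatrix}A&B\end{bmatrix}\begin{bmatrix}X_-\\U_-\end{bmatrix}\right\}\ni(A_s,B_s).$$ The data are *informative for identification* if $\Sigma_{\mathcal D}$ has exactly one element. They are *informative for optimal linear quadratic regulation* if the optimal LQR problem is solvable for $(A,B,Q,R)$ for all $(A,B)\in\Sigma_{\mathcal D}$ and there is a single matrix $K\in\mathbb R^{m\times n}$ that is the optimal feedback gain for $(A,B,Q,R)$ for all $(A,B)\in\Sigma_{\mathcal D}$; such a $K$ is called an optimal feedback gain for the data. **Theorem.** The data $(U_-,X)$ are informative for optimal linear quadratic regulation if and only if at least one of the following two conditions holds: (a) the data are informative for identification, and the optimal LQR problem is solvable for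 $(A_s,B_s,Q,R)$; (b) $A=A_s$ for all $(A,B)\in\Sigma_{\mathcal D}$, all complex eigenvalues of $A_s$ have modulus less than $1$, and $QA_s=0$. Moreover, if (a) holds, then $\Sigma_{\mathcal D}=\{(A_s,B_s)\}$, the largest real symmetric solution $P^+$ of (2) with $A=A_s$, $B=B_s$ exists, and the matrix $K$ in (1) with $A=A_s$, $B=B_s$ is the unique optimal feedback gain for the data. If (b) holds, then $K=0$ is the unique optimal feedback gain for the data. -/

import Mathlib

open Matrix Filter Topology

namespace DataLQR

/-- The state sequence of `x(t+1) = A x(t) + B u(t)` with `x(0) = x₀`. -/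
def state {n m : ℕ} (A : Matrix (Fin n) (Fin n) ℝ) (B : Matrix (Fin n) (Fin m) ℝ)
    (x₀ : Fin n → ℝ) (u : ℕ → Fin m → ℝ) : ℕ → Fin n → ℝ
  | 0 => x₀
  | t + 1 => A *ᵥ state A B x₀ u t + B *ᵥ u t

/-- The cost `J(x₀,u) = ∑ₜ (x(t)ᵀ Q x(t) + u(t)ᵀ R u(t))`, with values in `[0,∞]`
(the terms are nonnegative when `Q ≥ 0` and `R > 0`). -/
noncomputable def cost {n m : ℕ} (A : Matrix (Fin n) (Fin n) ℝ) (B : Matrix (Fin n) (Fin m) ℝ)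
    (Q : Matrix (Fin n) (Fin n) ℝ) (R : Matrix (Fin m) (Fin m) ℝ)
    (x₀ : Fin n → ℝ) (u : ℕ → Fin m → ℝ) : ENNReal :=
  ∑' t : ℕ, ENNReal.ofReal
    (state A B x₀ u t ⬝ᵥ (Q *ᵥ state A B x₀ u t) + u t ⬝ᵥ (R *ᵥ u t))

/-- The input `u` steers the state to zero from `x₀`. -/
def SteersToZero {n m : ℕ} (A : Matrix (Fin n) (Fin n) ℝ) (B : Matrix (Fin n) (Fin m) ℝ)
    (x₀ : Fin n → ℝ) (u : ℕ → Fin m → ℝ) : Prop :=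
  Tendsto (state A B x₀ u) atTop (𝓝 0)

/-- The optimal LQR problem is solvable for `(A,B,Q,R)`: from every initial state there is an
input of finite cost that steers the state to zero and minimizes the cost among all inputs that
steer the state to zero. -/
def LQRSolvable {n m : ℕ} (A : Matrix (Fin n) (Fin n) ℝ) (B : Matrix (Fin n) (Fin m) ℝ)
    (Q : Matrix (Fin n) (Fin n) ℝ) (R : Matrix (Fin m) (Fin m) ℝ) : Prop :=
  ∀ x₀ : Fin n → ℝ, ∃ u : ℕ → Fin m → ℝ,
    cost A B Q R x₀ u < ⊤ ∧ SteersToZero A B x₀ u ∧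
      ∀ v : ℕ → Fin m → ℝ, SteersToZero A B x₀ v → cost A B Q R x₀ u ≤ cost A B Q R x₀ v

/-- `P` is a real symmetric solution of the discrete-time algebraic Riccati equation
(in particular the inverse that occurs in the equation exists). -/
def IsDARESolution {n m : ℕ} (A : Matrix (Fin n) (Fin n) ℝ) (B : Matrix (Fin n) (Fin m) ℝ)
    (Q : Matrix (Fin n) (Fin n) ℝ) (R : Matrix (Fin m) (Fin m) ℝ)
    (P : Matrix (Fin n) (Fin n) ℝ) : Prop :=
  P.IsSymm ∧ IsUnit (R + Bᵀ * P * B) ∧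
    P = Aᵀ * P * A - Aᵀ * P * B * (R + Bᵀ * P * B)⁻¹ * Bᵀ * P * A + Q

/-- `P` is the largest real symmetric solution of the Riccati equation, in the Loewner order. -/
def IsLargestDARESolution {n m : ℕ} (A : Matrix (Fin n) (Fin n) ℝ) (B : Matrix (Fin n) (Fin m) ℝ)
    (Q : Matrix (Fin n) (Fin n) ℝ) (R : Matrix (Fin m) (Fin m) ℝ)
    (P : Matrix (Fin n) (Fin n) ℝ) : Prop :=
  IsDARESolution A B Q R P ∧ ∀ P', IsDARESolution A B Q R P' → (P - P').PosSemidef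

/-- The feedback gain `-(R + Bᵀ P B)⁻¹ Bᵀ P A`. -/
noncomputable def gain {n m : ℕ} (A : Matrix (Fin n) (Fin n) ℝ) (B : Matrix (Fin n) (Fin m) ℝ)
    (R : Matrix (Fin m) (Fin m) ℝ) (P : Matrix (Fin n) (Fin n) ℝ) : Matrix (Fin m) (Fin n) ℝ :=
  -((R + Bᵀ * P * B)⁻¹ * Bᵀ * P * A)

/-- `K` is the optimal feedback gain for `(A,B,Q,R)`: the LQR problem is solvable, and `K` is the
gain that belongs to the largest real symmetric solution of the Riccati equation. -/
def IsOptimalGain {n m : ℕ} (A : Matrix (Fin n) (Fin n) ℝ) (B : Matrix (Fin n) (Fin m) ℝ)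
    (Q : Matrix (Fin n) (Fin n) ℝ) (R : Matrix (Fin m) (Fin m) ℝ)
    (K : Matrix (Fin m) (Fin n) ℝ) : Prop :=
  LQRSolvable A B Q R ∧ ∃ P, IsLargestDARESolution A B Q R P ∧ K = gain A B R P

/-- The set of all systems for which `K` is the optimal feedback gain. -/
def systemsWithGain {n m : ℕ} (Q : Matrix (Fin n) (Fin n) ℝ) (R : Matrix (Fin m) (Fin m) ℝ)
    (K : Matrix (Fin m) (Fin n) ℝ) :
    Set (Matrix (Fin n) (Fin n) ℝ × Matrix (Fin n) (Fin m) ℝ) :=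
  {S | IsOptimalGain S.1 S.2 Q R K}

/-- A real square matrix is stable (Schur): its complex eigenvalues have modulus less than one. -/
def IsStable {n : ℕ} (A : Matrix (Fin n) (Fin n) ℝ) : Prop :=
  ∀ z : ℂ, Module.End.HasEigenvalue (Matrix.toLin' (A.map (algebraMap ℝ ℂ))) z → ‖z‖ < 1

/-- Input-state measurements on `N` time intervals: on interval `i` the inputs
`u(0), …, u(Tᵢ - 1)` and the states `x(0), …, x(Tᵢ)`. A single experiment is the case `N = 1`. -/
structure InputStateData (n m : ℕ) where
  N : ℕ
  T : Fin N → ℕ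
  u : (i : Fin N) → Fin (T i) → Fin m → ℝ
  x : (i : Fin N) → Fin (T i + 1) → Fin n → ℝ

namespace InputStateData

variable {n m : ℕ} (D : InputStateData n m)

/-- The column index of the data matrices: an interval and a time instance on it. -/
abbrev Idx : Type := (i : Fin D.N) × Fin (D.T i)

/-- The matrix with columns `u(t)`, `t < Tᵢ`. -/
def Uminus : Matrix (Fin m) D.Idx ℝ := Matrix.of fun k j => D.u j.1 j.2 k

/-- The matrix with columns `x(t)`, `t < Tᵢ`. -/
def Xminus : Matrix (Fin n) D.Idx ℝ := Matrix.of fun k j => D.x j.1 j.2.castSucc k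

/-- The matrix with columns `x(t+1)`, `t < Tᵢ`. -/
def Xplus : Matrix (Fin n) D.Idx ℝ := Matrix.of fun k j => D.x j.1 j.2.succ k

/-- The data are measurements on trajectories of the system `(A,B)`. -/
def GeneratedBy (A : Matrix (Fin n) (Fin n) ℝ) (B : Matrix (Fin n) (Fin m) ℝ) : Prop :=
  ∀ (i : Fin D.N) (t : Fin (D.T i)),
    D.x i t.succ = A *ᵥ D.x i t.castSucc + B *ᵥ D.u i t

/-- The set `Σ_D` of all systems `(A,B)` consistent with the data:
`X₊ = [A B] [X₋; U₋]`. -/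
def consistentSystems : Set (Matrix (Fin n) (Fin n) ℝ × Matrix (Fin n) (Fin m) ℝ) :=
  {S | D.Xplus = Matrix.fromCols S.1 S.2 * Matrix.fromRows D.Xminus D.Uminus}

/-- Informativity for system identification: exactly one system is consistent with the data. -/
def InformativeForIdentification : Prop :=
  ∃! S : Matrix (Fin n) (Fin n) ℝ × Matrix (Fin n) (Fin m) ℝ, S ∈ D.consistentSystems

/-- Informativity for optimal linear quadratic regulation: the optimal LQR problem is solvable for
all consistent systems, and a single gain is the optimal feedback gain for all of them. -/
def InformativeForLQR (Q : Matrix (Fin n) (Fin n) ℝ) (R : Matrix (Fin m) (Fin m) ℝ) : Prop :=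
  (∀ S ∈ D.consistentSystems, LQRSolvable S.1 S.2 Q R) ∧
    ∃ K : Matrix (Fin m) (Fin n) ℝ, D.consistentSystems ⊆ systemsWithGain Q R K

end InputStateData

end DataLQR

/-! Necessity: let `K` be optimal for all consistent systems. The differences of consistent systems
are closed under left multiplication by square matrices. If `M₀` is the difference of two closed
loops `A + BK`, then adding `α M₀ᵀM₀` to one of them gives a stable closed loop for every real `α`;
traces of stable matrices are bounded, so `tr M₀ᵀM₀ = 0` and `M₀ = 0` (`closedLoop_eq`). The common
closed loop `M` fixes `P` through its Lyapunov equation (`lyapunov_unique`). If there are two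
consistent systems, `RK = -BᵀPM` holds along all perturbations `F(B' - B)` of `B`, with `B' ≠ B`, so
`PM = 0`, `K = 0`, `M = A`, `P = Q` and `QA = 0` (`stable_of_gain_of_ne`).

Sufficiency: in case (a) there is only one system; in case (b) zero input is optimal and `P = Q` for
every `B` (`isValueMatrix_of_isStable`).

Both directions use that a solvable problem has optimal cost `xᵀPx` with `P` the largest Riccati
solution. The parallelogram law makes optimal inputs additive, dynamic programming yields the
Riccati equation, and completion of squares bounds every other solution. That bound needs `R + BᵀP'B
> 0` for arbitrary solutions `P'`, obtained by a frequency-domain argument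
(`IsDARESolution.posDef`). -/

namespace DataLQR

/-! ### Real quadratic forms. -/

theorem mulVec_dotProduct_eq {k l : ℕ} (M : Matrix (Fin k) (Fin l) ℝ) (x : Fin l → ℝ)
    (y : Fin k → ℝ) : (M *ᵥ x) ⬝ᵥ y = x ⬝ᵥ (Mᵀ *ᵥ y) := by
  rw [dotProduct_mulVec, vecMul_transpose]

theorem dotProduct_mulVec_comm {k : ℕ} {S : Matrix (Fin k) (Fin k) ℝ} (hS : S.IsSymm)
    (x y : Fin k → ℝ) : x ⬝ᵥ (S *ᵥ y) = y ⬝ᵥ (S *ᵥ x) := by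
  rw [dotProduct_comm, mulVec_dotProduct_eq, hS.eq]

theorem isSymm_of_isHermitian {k : ℕ} {S : Matrix (Fin k) (Fin k) ℝ} (hS : S.IsHermitian) :
    S.IsSymm := by
  simpa [Matrix.IsHermitian, Matrix.IsSymm] using hS

theorem quadForm_nonneg {k : ℕ} {S : Matrix (Fin k) (Fin k) ℝ} (hS : S.PosSemidef)
    (x : Fin k → ℝ) : 0 ≤ x ⬝ᵥ (S *ᵥ x) := by
  simpa using hS.dotProduct_mulVec_nonneg x

theorem quadForm_pos {k : ℕ} {S : Matrix (Fin k) (Fin k) ℝ} (hS : S.PosDef)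
    {x : Fin k → ℝ} (hx : x ≠ 0) : 0 < x ⬝ᵥ (S *ᵥ x) := by
  simpa using hS.dotProduct_mulVec_pos hx

theorem quadForm_add {k : ℕ} {S : Matrix (Fin k) (Fin k) ℝ} (hS : S.IsSymm) (x y : Fin k → ℝ) :
    (x + y) ⬝ᵥ (S *ᵥ (x + y)) = x ⬝ᵥ (S *ᵥ x) + 2 * (x ⬝ᵥ (S *ᵥ y)) + y ⬝ᵥ (S *ᵥ y) := by
  rw [mulVec_add, add_dotProduct, dotProduct_add, dotProduct_add, dotProduct_mulVec_comm hS y x]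
  ring

theorem quadForm_sub {k : ℕ} {S : Matrix (Fin k) (Fin k) ℝ} (hS : S.IsSymm) (x y : Fin k → ℝ) :
    (x - y) ⬝ᵥ (S *ᵥ (x - y)) = x ⬝ᵥ (S *ᵥ x) - 2 * (x ⬝ᵥ (S *ᵥ y)) + y ⬝ᵥ (S *ᵥ y) := by
  rw [mulVec_sub, sub_dotProduct, dotProduct_sub, dotProduct_sub, dotProduct_mulVec_comm hS y x]
  ring

theorem quadForm_smul {k : ℕ} (S : Matrix (Fin k) (Fin k) ℝ) (c : ℝ) (x : Fin k → ℝ) :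
    (c • x) ⬝ᵥ (S *ᵥ (c • x)) = c ^ 2 * (x ⬝ᵥ (S *ᵥ x)) := by
  rw [mulVec_smul, smul_dotProduct, dotProduct_smul, smul_eq_mul, smul_eq_mul]
  ring

theorem quadForm_conj {k l : ℕ} (S : Matrix (Fin k) (Fin k) ℝ) (M : Matrix (Fin k) (Fin l) ℝ)
    (x y : Fin l → ℝ) : x ⬝ᵥ ((Mᵀ * S * M) *ᵥ y) = (M *ᵥ x) ⬝ᵥ (S *ᵥ (M *ᵥ y)) := by
  rw [mulVec_dotProduct_eq, mulVec_mulVec, mulVec_mulVec, Matrix.mul_assoc]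

theorem eq_of_quadForm_eq {k : ℕ} {S T : Matrix (Fin k) (Fin k) ℝ} (hS : S.IsSymm) (hT : T.IsSymm)
    (h : ∀ x, x ⬝ᵥ (S *ᵥ x) = x ⬝ᵥ (T *ᵥ x)) : S = T := by
  ext i j
  have h1 := h (Pi.single i 1 + Pi.single j 1)
  rw [quadForm_add hS, quadForm_add hT, h, h] at h1
  have h2 : Pi.single i 1 ⬝ᵥ (S *ᵥ Pi.single j 1) = Pi.single i 1 ⬝ᵥ (T *ᵥ Pi.single j 1) := by
    linarith
  simpa using h2

/-! ### Completion of squares for the Riccati equation. -/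

variable {n m : ℕ} {A : Matrix (Fin n) (Fin n) ℝ} {B : Matrix (Fin n) (Fin m) ℝ}
  {Q : Matrix (Fin n) (Fin n) ℝ} {R : Matrix (Fin m) (Fin m) ℝ} {P : Matrix (Fin n) (Fin n) ℝ}

theorem isSymm_add_conj {k l : ℕ} {S : Matrix (Fin k) (Fin k) ℝ} {T : Matrix (Fin l) (Fin l) ℝ}
    (hS : S.IsSymm) (hT : T.IsSymm) (M : Matrix (Fin k) (Fin l) ℝ) :
    (T + Mᵀ * S * M).IsSymm := by
  simp [Matrix.IsSymm, hS.eq, hT.eq, Matrix.mul_assoc]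

theorem mul_gain (hH : IsUnit (R + Bᵀ * P * B)) :
    (R + Bᵀ * P * B) * gain A B R P = -(Bᵀ * P * A) := by
  have h := mul_nonsing_inv_cancel_left (R + Bᵀ * P * B) (Bᵀ * P * A)
    ((isUnit_iff_isUnit_det _).1 hH)
  rw [gain, Matrix.mul_neg, neg_inj]
  simpa only [Matrix.mul_assoc] using h

/-- The Riccati operator equals `AᵀPA - KᵀHK + Q` for the gain `K` and `H = R + BᵀPB`. -/
theorem gain_conj (hR : R.IsSymm) (hP : P.IsSymm) (hH : IsUnit (R + Bᵀ * P * B)) :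
    (gain A B R P)ᵀ * (R + Bᵀ * P * B) * gain A B R P =
      Aᵀ * P * B * (R + Bᵀ * P * B)⁻¹ * Bᵀ * P * A := by
  have hs := isSymm_add_conj hP hR B
  rw [Matrix.mul_assoc, mul_gain hH, gain]
  generalize R + Bᵀ * P * B = H at hs ⊢
  simp only [transpose_neg, transpose_mul, transpose_nonsing_inv, hs.eq, hP.eq,
    transpose_transpose, Matrix.neg_mul, Matrix.mul_neg, neg_neg, Matrix.mul_assoc]

/-- Completion of squares. -/
theorem riccati_quadForm (hR : R.IsSymm) (hP : P.IsSymm) (hH : IsUnit (R + Bᵀ * P * B))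
    (x : Fin n → ℝ) (u : Fin m → ℝ) :
    (A *ᵥ x + B *ᵥ u) ⬝ᵥ (P *ᵥ (A *ᵥ x + B *ᵥ u)) + x ⬝ᵥ (Q *ᵥ x) + u ⬝ᵥ (R *ᵥ u) =
      x ⬝ᵥ ((Aᵀ * P * A - Aᵀ * P * B * (R + Bᵀ * P * B)⁻¹ * Bᵀ * P * A + Q) *ᵥ x) +
      (u - gain A B R P *ᵥ x) ⬝ᵥ ((R + Bᵀ * P * B) *ᵥ (u - gain A B R P *ᵥ x)) := by
  have hs := isSymm_add_conj hP hR B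
  have hcross : u ⬝ᵥ ((R + Bᵀ * P * B) *ᵥ (gain A B R P *ᵥ x)) =
      -((A *ᵥ x) ⬝ᵥ (P *ᵥ (B *ᵥ u))) := by
    rw [mulVec_mulVec, mul_gain hH, neg_mulVec, dotProduct_neg, dotProduct_mulVec_comm hP,
      mulVec_dotProduct_eq, mulVec_mulVec, mulVec_mulVec, Matrix.mul_assoc]
  rw [quadForm_add hP, quadForm_sub hs, hcross, ← gain_conj hR hP hH, add_mulVec, sub_mulVec,
    dotProduct_add, dotProduct_sub, quadForm_conj P, quadForm_conj]
  have hu : u ⬝ᵥ ((R + Bᵀ * P * B) *ᵥ u) = u ⬝ᵥ (R *ᵥ u) + (B *ᵥ u) ⬝ᵥ (P *ᵥ (B *ᵥ u)) := by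
    rw [add_mulVec, dotProduct_add, quadForm_conj]
  rw [hu]
  ring

theorem IsDARESolution.quadForm (hR : R.IsSymm) (h : IsDARESolution A B Q R P)
    (x : Fin n → ℝ) (u : Fin m → ℝ) :
    (A *ᵥ x + B *ᵥ u) ⬝ᵥ (P *ᵥ (A *ᵥ x + B *ᵥ u)) + x ⬝ᵥ (Q *ᵥ x) + u ⬝ᵥ (R *ᵥ u) =
      x ⬝ᵥ (P *ᵥ x) +
      (u - gain A B R P *ᵥ x) ⬝ᵥ ((R + Bᵀ * P * B) *ᵥ (u - gain A B R P *ᵥ x)) := by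
  rw [riccati_quadForm hR h.1 h.2.1, ← h.2.2]

/-! ### Positivity of `R + BᵀPB` by evaluation on the unit circle. -/

/-- Complex vectors and a rotation by `(c, s)`, split into real and imaginary parts. -/
theorem IsDARESolution.quadForm_rotation (hR : R.IsSymm) (h : IsDARESolution A B Q R P)
    {c s : ℝ} (hcs : c ^ 2 + s ^ 2 = 1) {a b : Fin n → ℝ} {p q : Fin m → ℝ}
    (h1 : c • a - s • b = A *ᵥ a + B *ᵥ p) (h2 : s • a + c • b = A *ᵥ b + B *ᵥ q) :
    (p - gain A B R P *ᵥ a) ⬝ᵥ ((R + Bᵀ * P * B) *ᵥ (p - gain A B R P *ᵥ a)) +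
      (q - gain A B R P *ᵥ b) ⬝ᵥ ((R + Bᵀ * P * B) *ᵥ (q - gain A B R P *ᵥ b)) =
    a ⬝ᵥ (Q *ᵥ a) + b ⬝ᵥ (Q *ᵥ b) + p ⬝ᵥ (R *ᵥ p) + q ⬝ᵥ (R *ᵥ q) := by
  have e1 := h.quadForm hR a p
  have e2 := h.quadForm hR b q
  rw [← h1, quadForm_sub h.1, quadForm_smul, quadForm_smul, mulVec_smul, smul_dotProduct,
    dotProduct_smul, smul_eq_mul, smul_eq_mul] at e1
  rw [← h2, quadForm_add h.1, quadForm_smul, quadForm_smul, mulVec_smul, smul_dotProduct,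
    dotProduct_smul, smul_eq_mul, smul_eq_mul] at e2
  -- The rotation preserves the sum of the two `P`-forms, so `P` cancels.
  linear_combination -e1 - e2 + hcs * (a ⬝ᵥ (P *ᵥ a) + b ⬝ᵥ (P *ᵥ b))

/-- The circle is infinite and the spectrum finite. -/
theorem exists_norm_one_isUnit {k : ℕ} (M : Matrix (Fin k) (Fin k) ℂ) :
    ∃ z : ℂ, ‖z‖ = 1 ∧ IsUnit (z • (1 : Matrix (Fin k) (Fin k) ℂ) - M) := by
  have hinf : (Metric.sphere (0 : ℂ) 1).Infinite := by
    refine (isPreconnected_sphere (by simp [Complex.rank_real_complex]) 0 1).infinite_of_nontrivial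
      ⟨1, by simp, -1, by simp, ?_⟩
    norm_num [Complex.ext_iff]
  obtain ⟨z, hz, hz'⟩ := (hinf.sdiff M.finite_spectrum).nonempty
  refine ⟨z, by simpa using hz, ?_⟩
  rw [spectrum.mem_iff, not_not, Algebra.algebraMap_eq_smul_one] at hz'
  exact hz'

theorem map_mulVec_re {k l : ℕ} (M : Matrix (Fin k) (Fin l) ℝ) (v : Fin l → ℂ) :
    (fun i => ((M.map (algebraMap ℝ ℂ) *ᵥ v) i).re) = M *ᵥ (fun i => (v i).re) := by
  ext i
  simp [mulVec, dotProduct]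

theorem map_mulVec_im {k l : ℕ} (M : Matrix (Fin k) (Fin l) ℝ) (v : Fin l → ℂ) :
    (fun i => ((M.map (algebraMap ℝ ℂ) *ᵥ v) i).im) = M *ᵥ (fun i => (v i).im) := by
  ext i
  simp [mulVec, dotProduct]

/-- For `Q ≥ 0` and `R > 0`, every solution of the Riccati equation has `R + BᵀPB > 0`. -/
theorem IsDARESolution.posDef (hQ : Q.PosSemidef) (hR : R.PosDef) (h : IsDARESolution A B Q R P) :
    (R + Bᵀ * P * B).PosDef := by
  have hRs := isSymm_of_isHermitian hR.isHermitian
  obtain ⟨z, hz, hU⟩ := exists_norm_one_isUnit (A.map (algebraMap ℝ ℂ))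
  set Ac := A.map (algebraMap ℝ ℂ)
  set Bc := B.map (algebraMap ℝ ℂ)
  set Kc := (gain A B R P).map (algebraMap ℝ ℂ)
  have hcs : z.re ^ 2 + z.im ^ 2 = 1 := by
    rw [pow_two, pow_two, ← Complex.normSq_apply, ← Complex.sq_norm, hz, one_pow]
  -- With `x = (z - A)⁻¹Bv`, the matrix `W = 1 - K(z - A)⁻¹B` sends `v` to `v - Kx`.
  have key : ∀ v : Fin m → ℂ, ∃ x : Fin n → ℂ,
      (1 - Kc * (z • (1 : Matrix (Fin n) (Fin n) ℂ) - Ac)⁻¹ * Bc) *ᵥ v = v - Kc *ᵥ x ∧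
      z • x = Ac *ᵥ x + Bc *ᵥ v := by
    intro v
    refine ⟨((z • (1 : Matrix (Fin n) (Fin n) ℂ) - Ac)⁻¹ * Bc) *ᵥ v, ?_, ?_⟩
    · rw [sub_mulVec, one_mulVec, mulVec_mulVec, Matrix.mul_assoc]
    · have e : (z • (1 : Matrix (Fin n) (Fin n) ℂ) - Ac) *ᵥ
          (((z • (1 : Matrix (Fin n) (Fin n) ℂ) - Ac)⁻¹ * Bc) *ᵥ v) = Bc *ᵥ v := by
        rw [mulVec_mulVec, mul_nonsing_inv_cancel_left _ _ ((isUnit_iff_isUnit_det _).1 hU)]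
      rw [sub_mulVec, smul_mulVec, one_mulVec, sub_eq_iff_eq_add] at e
      rw [e, add_comm]
  -- The form of `R + BᵀPB` at `Wv` is the running cost of `(x, v)`, positive because `R > 0`; no
  -- sign of `P` enters.
  have form : ∀ (v : Fin m → ℂ) (x : Fin n → ℂ), z • x = Ac *ᵥ x + Bc *ᵥ v → v ≠ 0 →
      0 < (fun i => ((v - Kc *ᵥ x) i).re) ⬝ᵥ
          ((R + Bᵀ * P * B) *ᵥ (fun i => ((v - Kc *ᵥ x) i).re)) +
        (fun i => ((v - Kc *ᵥ x) i).im) ⬝ᵥ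
          ((R + Bᵀ * P * B) *ᵥ (fun i => ((v - Kc *ᵥ x) i).im)) := by
    intro v x hx hv
    have hre : (fun i => ((v - Kc *ᵥ x) i).re) =
        (fun i => (v i).re) - gain A B R P *ᵥ (fun i => (x i).re) := by
      rw [← map_mulVec_re]; rfl
    have him : (fun i => ((v - Kc *ᵥ x) i).im) =
        (fun i => (v i).im) - gain A B R P *ᵥ (fun i => (x i).im) := by
      rw [← map_mulVec_im]; rfl
    rw [hre, him, h.quadForm_rotation hRs hcs]
    · have q1 := quadForm_nonneg hQ (fun i => (x i).re)
      have q2 := quadForm_nonneg hQ (fun i => (x i).im)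
      have r1 := quadForm_nonneg hR.posSemidef (fun i => (v i).re)
      have r2 := quadForm_nonneg hR.posSemidef (fun i => (v i).im)
      by_cases hv0 : (fun i => (v i).re) = 0
      · have : (fun i => (v i).im) ≠ 0 := by
          intro hv1
          exact hv (funext fun i => Complex.ext (congrFun hv0 i) (congrFun hv1 i))
        have := quadForm_pos hR this
        linarith
      · have := quadForm_pos hR hv0
        linarith
    · rw [← map_mulVec_re, ← map_mulVec_re]
      ext i
      have := congrArg Complex.re (congrFun hx i)
      simpa [Complex.mul_re, Ac, Bc] using this
    · rw [← map_mulVec_im, ← map_mulVec_im]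
      ext i
      have := congrArg Complex.im (congrFun hx i)
      simpa [Complex.mul_im, Ac, Bc, add_comm] using this
  -- Positivity makes `W` injective, hence onto, so every real `w` is some `Wv`.
  have hinj : Function.Injective
      (1 - Kc * (z • (1 : Matrix (Fin n) (Fin n) ℂ) - Ac)⁻¹ * Bc).mulVec := by
    intro v₁ v₂ hv
    by_contra hne
    obtain ⟨x, hx1, hx2⟩ := key (v₁ - v₂)
    have := form _ x hx2 (sub_ne_zero.2 hne)
    have h0 : v₁ - v₂ - Kc *ᵥ x = 0 := by
      rw [← hx1, mulVec_sub]
      exact sub_eq_zero.2 hv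
    rw [h0] at this
    have z1 : (fun i : Fin m => ((0 : Fin m → ℂ) i).re) = 0 := rfl
    have z2 : (fun i : Fin m => ((0 : Fin m → ℂ) i).im) = 0 := rfl
    rw [z1, z2] at this
    simp at this
  have hsurj := mulVec_surjective_iff_isUnit.2 (mulVec_injective_iff_isUnit.1 hinj)
  refine PosDef.of_dotProduct_mulVec_pos ?_ fun w hw => ?_
  · have := isSymm_add_conj h.1 hRs B
    rw [Matrix.IsHermitian, conjTranspose_eq_transpose_of_trivial]
    exact this
  · obtain ⟨v, hv⟩ := hsurj (fun i => (w i : ℂ))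
    obtain ⟨x, hx1, hx2⟩ := key v
    have hvw : v - Kc *ᵥ x = fun i => (w i : ℂ) := by rw [← hx1]; exact hv
    have hv0 : v ≠ 0 := by
      rintro rfl
      apply hw
      ext i
      have := congrFun hv i
      simpa using this.symm
    have := form v x hx2 hv0
    rw [hvw] at this
    have z2 : (fun i : Fin m => ((w i : ℂ)).im) = 0 := by ext i; simp
    rw [z2] at this
    simpa using this

/-! ### Stability, powers and traces. -/

/-- Gelfand's formula: eventually `‖a ^ t‖ ≤ r ^ t` for some `r < 1`. -/
theorem tendsto_pow_of_spectralRadius_lt_one {𝔸 : Type*} [NormedRing 𝔸] [NormedAlgebra ℂ 𝔸]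
    [CompleteSpace 𝔸] {a : 𝔸} (ha : spectralRadius ℂ a < 1) :
    Tendsto (fun t : ℕ => a ^ t) atTop (𝓝 0) := by
  obtain ⟨r, hr, hr1⟩ := exists_between ha
  have hev := (spectrum.pow_nnnorm_pow_one_div_tendsto_nhds_spectralRadius a).eventually_lt_const hr
  have hbound : ∀ᶠ t : ℕ in atTop, (‖a ^ t‖₊ : ENNReal) ≤ r ^ t := by
    filter_upwards [hev, eventually_gt_atTop 0] with t ht ht0
    have h := ENNReal.rpow_le_rpow ht.le (Nat.cast_nonneg t : (0 : ℝ) ≤ t)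
    rwa [← ENNReal.rpow_mul, one_div, inv_mul_cancel₀ (by positivity), ENNReal.rpow_one,
      ENNReal.rpow_natCast] at h
  have h0 : Tendsto (fun t : ℕ => (‖a ^ t‖₊ : ENNReal)) atTop (𝓝 0) :=
    tendsto_of_tendsto_of_tendsto_of_le_of_le' tendsto_const_nhds
      (ENNReal.tendsto_pow_atTop_nhds_zero_of_lt_one hr1) (Eventually.of_forall fun _ => zero_le)
      hbound
  rw [tendsto_zero_iff_norm_tendsto_zero]
  have h1 := (ENNReal.tendsto_toReal ENNReal.zero_ne_top).comp h0
  simpa [Function.comp_def] using h1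

theorem hasEigenvalue_toLin'_iff_mem_spectrum {k : ℕ} (M : Matrix (Fin k) (Fin k) ℂ) (z : ℂ) :
    Module.End.HasEigenvalue (Matrix.toLin' M) z ↔ z ∈ spectrum ℂ M := by
  rw [Module.End.hasEigenvalue_iff_mem_spectrum, spectrum_toLin']

theorem map_pow_mulVec_ofReal {k : ℕ} (M : Matrix (Fin k) (Fin k) ℝ) (t : ℕ) (x : Fin k → ℝ) :
    ((M.map (algebraMap ℝ ℂ)) ^ t) *ᵥ (fun i => (x i : ℂ)) = fun i => (((M ^ t) *ᵥ x) i : ℂ) := by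
  rw [← Matrix.map_pow]
  ext i
  simp [mulVec, dotProduct]

theorem IsStable.tendsto_pow {n : ℕ} {A : Matrix (Fin n) (Fin n) ℝ} (hA : IsStable A)
    (x : Fin n → ℝ) : Tendsto (fun t : ℕ => (A ^ t) *ᵥ x) atTop (𝓝 0) := by
  rcases Nat.eq_zero_or_pos n with rfl | hn
  · exact tendsto_const_nhds.congr fun t => Subsingleton.elim _ _
  have : Nonempty (Fin n) := ⟨⟨0, hn⟩⟩
  let : NormedRing (Matrix (Fin n) (Fin n) ℂ) := Matrix.linftyOpNormedRing
  let : NormedAlgebra ℂ (Matrix (Fin n) (Fin n) ℂ) := Matrix.linftyOpNormedAlgebra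
  have : CompleteSpace (Matrix (Fin n) (Fin n) ℂ) := FiniteDimensional.complete ℂ _
  have hr : spectralRadius ℂ (A.map (algebraMap ℝ ℂ)) < 1 := by
    refine spectrum.spectralRadius_lt_of_forall_lt _ fun z hz => ?_
    rw [← NNReal.coe_lt_coe]
    exact hA z ((hasEigenvalue_toLin'_iff_mem_spectrum _ z).2 hz)
  have ht := tendsto_pow_of_spectralRadius_lt_one hr
  have hc : Continuous fun M : Matrix (Fin n) (Fin n) ℂ =>
      fun i => ((M *ᵥ (fun i => (x i : ℂ))) i).re := by
    refine continuous_pi fun i => Complex.continuous_re.comp ?_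
    exact (continuous_apply i).comp (continuous_id.matrix_mulVec continuous_const)
  have h2 := (hc.tendsto 0).comp ht
  have h3 : (fun i => (((0 : Matrix (Fin n) (Fin n) ℂ) *ᵥ (fun i => (x i : ℂ))) i).re) = 0 := by
    ext i
    simp
  rw [h3] at h2
  refine h2.congr fun t => ?_
  ext i
  simp only [Function.comp_apply, map_pow_mulVec_ofReal, Complex.ofReal_re]

theorem isStable_of_tendsto_pow {n : ℕ} {A : Matrix (Fin n) (Fin n) ℝ}
    (hA : ∀ x, Tendsto (fun t : ℕ => (A ^ t) *ᵥ x) atTop (𝓝 0)) : IsStable A := by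
  intro z hz
  obtain ⟨v, hv⟩ := hz.exists_hasEigenvector
  obtain ⟨i, hi⟩ := Function.ne_iff.1 hv.2
  have hpow : ∀ t : ℕ, ((A.map (algebraMap ℝ ℂ)) ^ t) *ᵥ v = z ^ t • v := by
    intro t
    have h := hv.pow_apply t
    rwa [← Matrix.toLin'_pow, Matrix.toLin'_apply] at h
  have hlim : Tendsto (fun t : ℕ => z ^ t * v i) atTop (𝓝 0) := by
    have h1 : ∀ t : ℕ, z ^ t * v i = (((A ^ t) *ᵥ (fun i => (v i).re)) i : ℂ) +
        (((A ^ t) *ᵥ (fun i => (v i).im)) i : ℂ) * Complex.I := by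
      intro t
      have h2 := congrFun (hpow t) i
      rw [Pi.smul_apply, smul_eq_mul] at h2
      rw [← h2, ← Matrix.map_pow, ← map_mulVec_re, ← map_mulVec_im, Complex.re_add_im]
    have hre := ((continuous_apply i).tendsto _).comp (hA fun i => (v i).re)
    have him := ((continuous_apply i).tendsto _).comp (hA fun i => (v i).im)
    have hre' := (Complex.continuous_ofReal.tendsto _).comp hre
    have him' := ((Complex.continuous_ofReal.tendsto _).comp him).mul_const Complex.I
    simpa [h1, Function.comp_def] using hre'.add him'
  have h0 : Tendsto (fun t : ℕ => z ^ t) atTop (𝓝 0) := by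
    have := hlim.mul_const (v i)⁻¹
    simpa [mul_assoc, mul_inv_cancel₀ (show v i ≠ 0 from hi)] using this
  exact tendsto_pow_atTop_nhds_zero_iff_norm_lt_one.1 h0

/-- The trace is the sum of at most `n` complex eigenvalues, each of modulus below one. -/
theorem IsStable.abs_trace_le {n : ℕ} {A : Matrix (Fin n) (Fin n) ℝ} (hA : IsStable A) :
    |A.trace| ≤ n := by
  have h1 : ((A.trace : ℝ) : ℂ) = (A.map (algebraMap ℝ ℂ)).charpoly.roots.sum := by
    rw [← Matrix.trace_eq_sum_roots_charpoly]
    simp [Matrix.trace]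
  have h2 : ‖(A.map (algebraMap ℝ ℂ)).charpoly.roots.sum‖ ≤
      ((A.map (algebraMap ℝ ℂ)).charpoly.roots.map fun z => ‖z‖).sum :=
    norm_multiset_sum_le _
  have h3 : ((A.map (algebraMap ℝ ℂ)).charpoly.roots.map fun z => ‖z‖).sum ≤
      ((A.map (algebraMap ℝ ℂ)).charpoly.roots.map fun z => ‖z‖).card • (1 : ℝ) := by
    refine Multiset.sum_le_card_nsmul _ _ fun r hr => ?_
    obtain ⟨z, hz, rfl⟩ := Multiset.mem_map.1 hr
    refine (hA z ((hasEigenvalue_toLin'_iff_mem_spectrum _ z).2 ?_)).le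
    exact Matrix.mem_spectrum_iff_isRoot_charpoly.2 (Polynomial.isRoot_of_mem_roots hz)
  have h4 : (A.map (algebraMap ℝ ℂ)).charpoly.roots.card ≤ n := by
    refine (Polynomial.card_roots' _).trans ?_
    rw [Matrix.charpoly_natDegree_eq_dim, Fintype.card_fin]
  calc |A.trace| = ‖((A.trace : ℝ) : ℂ)‖ := by rw [Complex.norm_real, Real.norm_eq_abs]
    _ ≤ _ := by rw [h1]
    _ ≤ n := by
      refine (h2.trans h3).trans ?_
      rw [Multiset.card_map, nsmul_eq_mul, mul_one]
      exact_mod_cast h4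

/-- A line of stable matrices has a traceless direction. -/
theorem trace_eq_zero_of_isStable_line {n : ℕ} {M S : Matrix (Fin n) (Fin n) ℝ}
    (h : ∀ α : ℝ, IsStable (M + α • S)) : S.trace = 0 := by
  by_contra hS
  -- This value of the parameter gives trace `n + 1`.
  have h1 := (h ((n + 1 - M.trace) / S.trace)).abs_trace_le
  rw [trace_add, trace_smul, smul_eq_mul, div_mul_cancel₀ _ hS] at h1
  have := (abs_le.1 h1).2
  linarith

/-! ### Linearity of trajectories and the quadratic cost. -/

theorem state_add (x y : Fin n → ℝ) (u v : ℕ → Fin m → ℝ) (t : ℕ) :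
    state A B (x + y) (u + v) t = state A B x u t + state A B y v t := by
  induction t with
  | zero => rfl
  | succ t ih =>
    simp only [state, ih, Pi.add_apply, mulVec_add]
    abel

theorem state_smul (c : ℝ) (x : Fin n → ℝ) (u : ℕ → Fin m → ℝ) (t : ℕ) :
    state A B (c • x) (c • u) t = c • state A B x u t := by
  induction t with
  | zero => rfl
  | succ t ih => simp only [state, ih, Pi.smul_apply, mulVec_smul, smul_add]

theorem state_sub (x y : Fin n → ℝ) (u v : ℕ → Fin m → ℝ) (t : ℕ) :
    state A B (x - y) (u - v) t = state A B x u t - state A B y v t := by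
  induction t with
  | zero => rfl
  | succ t ih =>
    simp only [state, ih, Pi.sub_apply, mulVec_sub]
    abel

/-- `state` recurses on its last step; dynamic programming needs the first step split off. -/
theorem state_succ' (x : Fin n → ℝ) (u : ℕ → Fin m → ℝ) (t : ℕ) :
    state A B x u (t + 1) = state A B (A *ᵥ x + B *ᵥ u 0) (fun s => u (s + 1)) t := by
  induction t with
  | zero => rfl
  | succ t ih => rw [state, ih]; rfl

theorem state_zero_input (x : Fin n → ℝ) (t : ℕ) :
    state A B x 0 t = (A ^ t) *ᵥ x := by
  induction t with
  | zero => simp [state]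
  | succ t ih => rw [state, ih, pow_succ', ← mulVec_mulVec]; simp

theorem SteersToZero.add {x y : Fin n → ℝ} {u v : ℕ → Fin m → ℝ} (hu : SteersToZero A B x u)
    (hv : SteersToZero A B y v) : SteersToZero A B (x + y) (u + v) := by
  have h := Tendsto.add (show Tendsto _ _ _ from hu) (show Tendsto _ _ _ from hv)
  rw [add_zero] at h
  exact h.congr fun t => (state_add x y u v t).symm

theorem SteersToZero.smul {x : Fin n → ℝ} {u : ℕ → Fin m → ℝ} (hu : SteersToZero A B x u)
    (c : ℝ) : SteersToZero A B (c • x) (c • u) := by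
  have h := Tendsto.const_smul (show Tendsto _ _ _ from hu) c
  rw [smul_zero] at h
  exact h.congr fun t => (state_smul c x u t).symm

theorem SteersToZero.sub {x y : Fin n → ℝ} {u v : ℕ → Fin m → ℝ} (hu : SteersToZero A B x u)
    (hv : SteersToZero A B y v) : SteersToZero A B (x - y) (u - v) := by
  have h := Tendsto.sub (show Tendsto _ _ _ from hu) (show Tendsto _ _ _ from hv)
  rw [sub_zero] at h
  exact h.congr fun t => (state_sub x y u v t).symm

theorem steersToZero_succ {x : Fin n → ℝ} {u : ℕ → Fin m → ℝ} :
    SteersToZero A B (A *ᵥ x + B *ᵥ u 0) (fun s => u (s + 1)) ↔ SteersToZero A B x u := by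
  rw [SteersToZero, SteersToZero, ← tendsto_add_atTop_iff_nat (f := state A B x u) 1]
  exact tendsto_congr fun t => (state_succ' x u t).symm

/-- The running cost `xᵀQx + uᵀRu`. -/
def stageCost {n m : ℕ} (Q : Matrix (Fin n) (Fin n) ℝ) (R : Matrix (Fin m) (Fin m) ℝ)
    (x : Fin n → ℝ) (u : Fin m → ℝ) : ℝ :=
  x ⬝ᵥ (Q *ᵥ x) + u ⬝ᵥ (R *ᵥ u)

theorem stageCost_nonneg (hQ : Q.PosSemidef) (hR : R.PosDef) (x : Fin n → ℝ) (u : Fin m → ℝ) :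
    0 ≤ stageCost Q R x u :=
  add_nonneg (quadForm_nonneg hQ x) (quadForm_nonneg hR.posSemidef u)

theorem cost_eq_tsum (x : Fin n → ℝ) (u : ℕ → Fin m → ℝ) :
    cost A B Q R x u = ∑' t, ENNReal.ofReal (stageCost Q R (state A B x u t) (u t)) := rfl

theorem cost_eq_add_succ (x : Fin n → ℝ) (u : ℕ → Fin m → ℝ) :
    cost A B Q R x u = ENNReal.ofReal (stageCost Q R x (u 0)) +
      cost A B Q R (A *ᵥ x + B *ᵥ u 0) (fun s => u (s + 1)) := by
  rw [cost_eq_tsum, tsum_eq_zero_add' ENNReal.summable, cost_eq_tsum]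
  simp only [state_succ']
  rfl

theorem hasSum_stageCost (hQ : Q.PosSemidef) (hR : R.PosDef) {x : Fin n → ℝ}
    {u : ℕ → Fin m → ℝ} (h : cost A B Q R x u < ⊤) :
    HasSum (fun t => stageCost Q R (state A B x u t) (u t)) (cost A B Q R x u).toReal := by
  rw [cost_eq_tsum] at h ⊢
  have h1 := ENNReal.hasSum_toReal h.ne
  rw [← ENNReal.tsum_toReal_eq fun t => ENNReal.ofReal_ne_top] at h1
  simpa only [ENNReal.toReal_ofReal (stageCost_nonneg hQ hR _ _)] using h1

theorem cost_parallelogram (hQ : Q.PosSemidef) (hR : R.PosDef) (x y : Fin n → ℝ)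
    (u v : ℕ → Fin m → ℝ) :
    cost A B Q R (x + y) (u + v) + cost A B Q R (x - y) (u - v) =
      2 * cost A B Q R x u + 2 * cost A B Q R y v := by
  have hQs := isSymm_of_isHermitian hQ.isHermitian
  have hRs := isSymm_of_isHermitian hR.isHermitian
  simp only [cost_eq_tsum]
  rw [← ENNReal.tsum_add, ← ENNReal.tsum_mul_left, ← ENNReal.tsum_mul_left, ← ENNReal.tsum_add]
  refine tsum_congr fun t => ?_
  have h2 : (2 : ENNReal) = ENNReal.ofReal 2 := by simp
  have hn := stageCost_nonneg hQ hR
  rw [h2, ← ENNReal.ofReal_mul zero_le_two, ← ENNReal.ofReal_mul zero_le_two,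
    ← ENNReal.ofReal_add (hn _ _) (hn _ _),
    ← ENNReal.ofReal_add (mul_nonneg zero_le_two (hn _ _)) (mul_nonneg zero_le_two (hn _ _))]
  congr 1
  rw [state_add, state_sub, Pi.add_apply, Pi.sub_apply]
  simp only [stageCost, quadForm_add hQs, quadForm_add hRs, quadForm_sub hQs, quadForm_sub hRs]
  ring

theorem cost_smul (c : ℝ) (x : Fin n → ℝ) (u : ℕ → Fin m → ℝ) :
    cost A B Q R (c • x) (c • u) = ENNReal.ofReal (c ^ 2) * cost A B Q R x u := by
  rw [cost_eq_tsum, cost_eq_tsum, ← ENNReal.tsum_mul_left]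
  refine tsum_congr fun t => ?_
  rw [← ENNReal.ofReal_mul (sq_nonneg c), state_smul, Pi.smul_apply]
  simp only [stageCost, quadForm_smul, mul_add]

/-! ### Linear combinations of optimal inputs. -/

/-- `u` solves the optimal LQR problem with initial state `x`. -/
def IsOptimalInput {n m : ℕ} (A : Matrix (Fin n) (Fin n) ℝ) (B : Matrix (Fin n) (Fin m) ℝ)
    (Q : Matrix (Fin n) (Fin n) ℝ) (R : Matrix (Fin m) (Fin m) ℝ)
    (x : Fin n → ℝ) (u : ℕ → Fin m → ℝ) : Prop :=
  cost A B Q R x u < ⊤ ∧ SteersToZero A B x u ∧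
    ∀ v : ℕ → Fin m → ℝ, SteersToZero A B x v → cost A B Q R x u ≤ cost A B Q R x v

theorem IsOptimalInput.add (hQ : Q.PosSemidef) (hR : R.PosDef) {x y : Fin n → ℝ}
    {u v : ℕ → Fin m → ℝ} (hu : IsOptimalInput A B Q R x u) (hv : IsOptimalInput A B Q R y v) :
    IsOptimalInput A B Q R (x + y) (u + v) := by
  have hsum := cost_parallelogram (A := A) (B := B) hQ hR x y u v
  have hlt : cost A B Q R (x + y) (u + v) + cost A B Q R (x - y) (u - v) < ⊤ := by
    rw [hsum]
    exact ENNReal.add_lt_top.2 ⟨ENNReal.mul_lt_top (by simp) hu.1,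
      ENNReal.mul_lt_top (by simp) hv.1⟩
  obtain ⟨h1, h2⟩ := ENNReal.add_lt_top.1 hlt
  refine ⟨h1, hu.2.1.add hv.2.1, fun w hw => ?_⟩
  have hd := hu.2.1.sub hv.2.1
  have ex : (1 / 2 : ℝ) • ((x + y) + (x - y)) = x := by
    ext i; simp; ring
  have ey : (1 / 2 : ℝ) • ((x + y) - (x - y)) = y := by
    ext i; simp; ring
  -- The half sum and half difference of `w` and `u - v` compete with `u` and `v`. The parallelogram
  -- law then compares `w` with `u + v`, after cancelling the finite cost of `u - v`.
  have hp := hu.2.2 ((1 / 2 : ℝ) • (w + (u - v))) (by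
    have := (hw.add hd).smul (1 / 2)
    rwa [ex] at this)
  have hm := hv.2.2 ((1 / 2 : ℝ) • (w - (u - v))) (by
    have := (hw.sub hd).smul (1 / 2)
    rwa [ey] at this)
  have hpar := cost_parallelogram (A := A) (B := B) hQ hR x y ((1 / 2 : ℝ) • (w + (u - v)))
    ((1 / 2 : ℝ) • (w - (u - v)))
  have e1 : (1 / 2 : ℝ) • (w + (u - v)) + (1 / 2 : ℝ) • (w - (u - v)) = w := by
    ext t i; simp; ring
  have e2 : (1 / 2 : ℝ) • (w + (u - v)) - (1 / 2 : ℝ) • (w - (u - v)) = u - v := by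
    ext t i; simp; ring
  rw [e1, e2] at hpar
  refine (ENNReal.add_le_add_iff_right h2.ne).1 ?_
  rw [hsum, hpar]
  gcongr

theorem isOptimalInput_zero : IsOptimalInput A B Q R 0 0 := by
  have hs : ∀ t, state A B 0 (0 : ℕ → Fin m → ℝ) t = 0 := fun t => by
    rw [state_zero_input, mulVec_zero]
  have hc : cost A B Q R 0 (0 : ℕ → Fin m → ℝ) = 0 := by
    simp [cost_eq_tsum, stageCost, hs]
  refine ⟨by simp [hc], ?_, fun v _ => by simp [hc]⟩
  exact tendsto_const_nhds.congr fun t => (hs t).symm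

theorem IsOptimalInput.smul {x : Fin n → ℝ} {u : ℕ → Fin m → ℝ}
    (hu : IsOptimalInput A B Q R x u) (c : ℝ) : IsOptimalInput A B Q R (c • x) (c • u) := by
  rcases eq_or_ne c 0 with rfl | hc
  · simpa using isOptimalInput_zero
  refine ⟨?_, hu.2.1.smul c, fun w hw => ?_⟩
  · rw [cost_smul]
    exact ENNReal.mul_lt_top ENNReal.ofReal_lt_top hu.1
  · have h := hw.smul c⁻¹
    rw [inv_smul_smul₀ hc] at h
    have h1 := hu.2.2 _ h
    calc cost A B Q R (c • x) (c • u) = ENNReal.ofReal (c ^ 2) * cost A B Q R x u := cost_smul ..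
      _ ≤ ENNReal.ofReal (c ^ 2) * cost A B Q R x (c⁻¹ • w) := by gcongr
      _ = cost A B Q R (c • x) (c • c⁻¹ • w) := (cost_smul ..).symm
      _ = cost A B Q R (c • x) w := by rw [smul_inv_smul₀ hc]

theorem IsOptimalInput.sum (hQ : Q.PosSemidef) (hR : R.PosDef) {ι : Type*} (s : Finset ι)
    {x : ι → Fin n → ℝ} {u : ι → ℕ → Fin m → ℝ}
    (h : ∀ i, IsOptimalInput A B Q R (x i) (u i)) :
    IsOptimalInput A B Q R (∑ i ∈ s, x i) (∑ i ∈ s, u i) := by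
  classical
  induction s using Finset.induction_on with
  | empty => simpa using isOptimalInput_zero
  | insert i s hi ih =>
    rw [Finset.sum_insert hi, Finset.sum_insert hi]
    exact (h i).add hQ hR ih

/-! ### The value matrix and dynamic programming. -/

theorem exists_hasSum_quadForm {k : ℕ} {S : ℕ → Matrix (Fin k) (Fin k) ℝ}
    (hS : ∀ t, (S t).IsSymm) (h : ∀ x, Summable fun t => x ⬝ᵥ (S t *ᵥ x)) :
    ∃ P : Matrix (Fin k) (Fin k) ℝ, P.IsSymm ∧
      ∀ x, HasSum (fun t => x ⬝ᵥ (S t *ᵥ x)) (x ⬝ᵥ (P *ᵥ x)) := by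
  have hent : ∀ i j, Summable fun t => S t i j := by
    intro i j
    have h1 := ((h (Pi.single i 1 + Pi.single j 1)).sub (h (Pi.single i 1))).sub
      (h (Pi.single j 1))
    refine (h1.mul_left (1 / 2)).congr fun t => ?_
    rw [quadForm_add (hS t)]
    have : Pi.single i 1 ⬝ᵥ (S t *ᵥ Pi.single j 1) = S t i j := by simp
    rw [this]
    ring
  refine ⟨Matrix.of fun i j => ∑' t, S t i j, ?_, fun x => ?_⟩
  · ext i j
    exact tsum_congr fun t => (hS t).apply i j
  · simp only [dotProduct, mulVec]
    refine hasSum_sum fun i _ => HasSum.mul_left _ (hasSum_sum fun j _ => HasSum.mul_right _ ?_)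
    exact (hent i j).hasSum

/-- `xᵀPx` is the optimal cost of the LQR problem with initial state `x`. -/
def IsValueMatrix {n m : ℕ} (A : Matrix (Fin n) (Fin n) ℝ) (B : Matrix (Fin n) (Fin m) ℝ)
    (Q : Matrix (Fin n) (Fin n) ℝ) (R : Matrix (Fin m) (Fin m) ℝ)
    (P : Matrix (Fin n) (Fin n) ℝ) : Prop :=
  P.IsSymm ∧ ∀ x, 0 ≤ x ⬝ᵥ (P *ᵥ x) ∧ ∃ u, IsOptimalInput A B Q R x u ∧
    cost A B Q R x u = ENNReal.ofReal (x ⬝ᵥ (P *ᵥ x))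

/-- Optimal inputs for the basis vectors combine linearly to optimal inputs `U t *ᵥ x` for every
`x`, so the optimal cost is quadratic in `x`. -/
theorem LQRSolvable.exists_isValueMatrix (hQ : Q.PosSemidef) (hR : R.PosDef)
    (h : LQRSolvable A B Q R) : ∃ P, IsValueMatrix A B Q R P := by
  have hQs := isSymm_of_isHermitian hQ.isHermitian
  have hRs := isSymm_of_isHermitian hR.isHermitian
  choose u hu using fun i : Fin n => h (Pi.single i 1)
  let U : ℕ → Matrix (Fin m) (Fin n) ℝ := fun t => Matrix.of fun k i => u i t k
  let X : ℕ → Matrix (Fin n) (Fin n) ℝ := fun t => Nat.rec 1 (fun t X => A * X + B * U t) t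
  have hX : ∀ x t, state A B x (fun t => U t *ᵥ x) t = X t *ᵥ x := by
    intro x t
    induction t with
    | zero => exact (one_mulVec x).symm
    | succ t ih =>
      have : X (t + 1) = A * X t + B * U t := rfl
      rw [state, ih, this, add_mulVec, mulVec_mulVec, mulVec_mulVec]
  have hopt : ∀ x, IsOptimalInput A B Q R x (fun t => U t *ᵥ x) := by
    intro x
    have h1 := IsOptimalInput.sum hQ hR Finset.univ (fun i =>
      IsOptimalInput.smul (show IsOptimalInput A B Q R (Pi.single i 1) (u i) from hu i) (x i))
    have e1 : ∑ i, x i • (Pi.single i 1 : Fin n → ℝ) = x := by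
      ext j
      simp [Finset.sum_apply, Pi.single_apply]
    have e2 : ∑ i, x i • u i = fun t => U t *ᵥ x := by
      ext t k
      simp [Finset.sum_apply, U, mulVec, dotProduct, mul_comm]
    rwa [e1, e2] at h1
  have hstage : ∀ x t, stageCost Q R (state A B x (fun t => U t *ᵥ x) t) (U t *ᵥ x) =
      x ⬝ᵥ (((X t)ᵀ * Q * X t + (U t)ᵀ * R * U t) *ᵥ x) := by
    intro x t
    rw [hX, stageCost, add_mulVec, dotProduct_add, quadForm_conj, quadForm_conj]
  have hsum := fun x => hasSum_stageCost hQ hR (hopt x).1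
  simp only [hstage] at hsum
  obtain ⟨P, hP, hPsum⟩ := exists_hasSum_quadForm
    (S := fun t => (X t)ᵀ * Q * X t + (U t)ᵀ * R * U t)
    (fun t => by simp [Matrix.IsSymm, hQs.eq, hRs.eq, Matrix.mul_assoc])
    (fun x => (hsum x).summable)
  have hval : ∀ x, x ⬝ᵥ (P *ᵥ x) = (cost A B Q R x (fun t => U t *ᵥ x)).toReal :=
    fun x => (hPsum x).unique (hsum x)
  refine ⟨P, hP, fun x => ⟨?_, _, hopt x, ?_⟩⟩
  · rw [hval]
    exact ENNReal.toReal_nonneg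
  · rw [hval, ENNReal.ofReal_toReal (hopt x).1.ne]

theorem IsValueMatrix.posSemidef (h : IsValueMatrix A B Q R P) : P.PosSemidef := by
  refine PosSemidef.of_dotProduct_mulVec_nonneg ?_ fun x => by simpa using (h.2 x).1
  rw [Matrix.IsHermitian, conjTranspose_eq_transpose_of_trivial]
  exact h.1

theorem IsValueMatrix.cost_eq (h : IsValueMatrix A B Q R P) {x : Fin n → ℝ}
    {u : ℕ → Fin m → ℝ} (hu : IsOptimalInput A B Q R x u) :
    cost A B Q R x u = ENNReal.ofReal (x ⬝ᵥ (P *ᵥ x)) := by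
  obtain ⟨v, hv, hc⟩ := (h.2 x).2
  rw [← hc]
  exact le_antisymm (hu.2.2 v hv.2.1) (hv.2.2 u hu.2.1)

theorem IsValueMatrix.le_cost (h : IsValueMatrix A B Q R P) {x : Fin n → ℝ}
    {u : ℕ → Fin m → ℝ} (hu : SteersToZero A B x u) :
    ENNReal.ofReal (x ⬝ᵥ (P *ᵥ x)) ≤ cost A B Q R x u := by
  obtain ⟨v, hv, hc⟩ := (h.2 x).2
  rw [← hc]
  exact hv.2.2 u hu

/-- The dynamic programming inequality. -/
theorem IsValueMatrix.le_stageCost_add (hQ : Q.PosSemidef) (hR : R.PosDef)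
    (h : IsValueMatrix A B Q R P) (x : Fin n → ℝ) (u : Fin m → ℝ) :
    x ⬝ᵥ (P *ᵥ x) ≤
      stageCost Q R x u + (A *ᵥ x + B *ᵥ u) ⬝ᵥ (P *ᵥ (A *ᵥ x + B *ᵥ u)) := by
  obtain ⟨hn, v, hv, hc⟩ := h.2 (A *ᵥ x + B *ᵥ u)
  let w : ℕ → Fin m → ℝ := fun t => Nat.casesOn t u v
  have hw : SteersToZero A B x w := steersToZero_succ.1 hv.2.1
  have h1 := h.le_cost hw
  rw [cost_eq_add_succ] at h1
  have h2 : cost A B Q R (A *ᵥ x + B *ᵥ w 0) (fun s => w (s + 1)) =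
    ENNReal.ofReal ((A *ᵥ x + B *ᵥ u) ⬝ᵥ (P *ᵥ (A *ᵥ x + B *ᵥ u))) := hc
  have hs := stageCost_nonneg hQ hR x u
  rw [h2, ← ENNReal.ofReal_add (stageCost_nonneg hQ hR _ _) hn] at h1
  exact (ENNReal.ofReal_le_ofReal_iff (add_nonneg hs hn)).1 h1

theorem IsValueMatrix.stageCost_add_le (hQ : Q.PosSemidef) (hR : R.PosDef)
    (h : IsValueMatrix A B Q R P) {x : Fin n → ℝ} {u : ℕ → Fin m → ℝ}
    (hu : IsOptimalInput A B Q R x u) :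
    stageCost Q R x (u 0) + (A *ᵥ x + B *ᵥ u 0) ⬝ᵥ (P *ᵥ (A *ᵥ x + B *ᵥ u 0)) ≤
      x ⬝ᵥ (P *ᵥ x) := by
  have h1 := h.cost_eq hu
  have h2 := h.le_cost (steersToZero_succ.2 hu.2.1)
  rw [cost_eq_add_succ] at h1
  refine (ENNReal.ofReal_le_ofReal_iff (h.2 x).1).1 ?_
  rw [ENNReal.ofReal_add (stageCost_nonneg hQ hR _ _) (h.2 _).1, ← h1]
  gcongr

/-- Principle of optimality: a cheaper tail would improve the whole input. -/
theorem IsOptimalInput.tail {x : Fin n → ℝ} {u : ℕ → Fin m → ℝ}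
    (hu : IsOptimalInput A B Q R x u) :
    IsOptimalInput A B Q R (A *ᵥ x + B *ᵥ u 0) (fun s => u (s + 1)) := by
  have hlt := hu.1
  rw [cost_eq_add_succ] at hlt
  refine ⟨(ENNReal.add_lt_top.1 hlt).2, steersToZero_succ.2 hu.2.1, fun v hv => ?_⟩
  let w : ℕ → Fin m → ℝ := fun t => Nat.casesOn t (u 0) v
  have h1 := hu.2.2 w (steersToZero_succ.1 hv)
  rw [cost_eq_add_succ, cost_eq_add_succ x w] at h1
  exact (ENNReal.add_le_add_iff_left ENNReal.ofReal_ne_top).1 h1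

theorem IsValueMatrix.posDef (hR : R.PosDef) (h : IsValueMatrix A B Q R P) :
    (R + Bᵀ * P * B).PosDef := by
  refine hR.add_posSemidef ?_
  have := h.posSemidef.conjTranspose_mul_mul_same B
  rwa [conjTranspose_eq_transpose_of_trivial] at this

/-- Completing squares in the two dynamic programming inequalities gives both bounds: the gain input
makes the square vanish, and for an optimal input the square is nonnegative. -/
theorem IsValueMatrix.isDARESolution (hQ : Q.PosSemidef) (hR : R.PosDef)
    (h : IsValueMatrix A B Q R P) : IsDARESolution A B Q R P := by
  have hQs := isSymm_of_isHermitian hQ.isHermitian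
  have hRs := isSymm_of_isHermitian hR.isHermitian
  have hH := h.posDef hR
  refine ⟨h.1, hH.isUnit, eq_of_quadForm_eq h.1 ?_ fun x => le_antisymm ?_ ?_⟩
  · rw [← gain_conj hRs h.1 hH.isUnit]
    have hs := isSymm_add_conj h.1 hRs B
    generalize R + Bᵀ * P * B = H at hs ⊢
    simp [Matrix.IsSymm, hs.eq, h.1.eq, hQs.eq, Matrix.mul_assoc]
  · have h1 := h.le_stageCost_add hQ hR x (gain A B R P *ᵥ x)
    have h2 := riccati_quadForm (A := A) (Q := Q) hRs h.1 hH.isUnit x (gain A B R P *ᵥ x)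
    rw [sub_self, zero_dotProduct] at h2
    rw [stageCost] at h1
    linarith
  · obtain ⟨u, hu, -⟩ := (h.2 x).2
    have h1 := h.stageCost_add_le hQ hR hu
    have h2 := riccati_quadForm (A := A) (Q := Q) hRs h.1 hH.isUnit x (u 0)
    have h3 := quadForm_nonneg hH.posSemidef (u 0 - gain A B R P *ᵥ x)
    rw [stageCost] at h1
    linarith

/-- A deviation from the gain would cost a strictly positive square. -/
theorem IsValueMatrix.input_zero_eq (hQ : Q.PosSemidef) (hR : R.PosDef)
    (h : IsValueMatrix A B Q R P) {x : Fin n → ℝ} {u : ℕ → Fin m → ℝ}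
    (hu : IsOptimalInput A B Q R x u) : u 0 = gain A B R P *ᵥ x := by
  have hRs := isSymm_of_isHermitian hR.isHermitian
  by_contra hne
  have h1 := h.stageCost_add_le hQ hR hu
  have h2 := (h.isDARESolution hQ hR).quadForm hRs x (u 0)
  have h3 := quadForm_pos (h.posDef hR) (sub_ne_zero.2 hne)
  rw [stageCost] at h1
  linarith

theorem IsValueMatrix.state_eq (hQ : Q.PosSemidef) (hR : R.PosDef)
    (h : IsValueMatrix A B Q R P) {x : Fin n → ℝ} {u : ℕ → Fin m → ℝ}
    (hu : IsOptimalInput A B Q R x u) (t : ℕ) :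
    state A B x u t = ((A + B * gain A B R P) ^ t) *ᵥ x := by
  induction t generalizing x u with
  | zero => simp [state]
  | succ t ih =>
    rw [state_succ', ih hu.tail, h.input_zero_eq hQ hR hu, pow_succ, ← mulVec_mulVec,
      add_mulVec, mulVec_mulVec]

theorem IsValueMatrix.tendsto_pow (hQ : Q.PosSemidef) (hR : R.PosDef)
    (h : IsValueMatrix A B Q R P) (x : Fin n → ℝ) :
    Tendsto (fun t : ℕ => ((A + B * gain A B R P) ^ t) *ᵥ x) atTop (𝓝 0) := by
  obtain ⟨u, hu, -⟩ := (h.2 x).2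
  exact Tendsto.congr (h.state_eq hQ hR hu) hu.2.1

/-! ### Maximality of the value matrix. -/

/-- Completion of squares telescopes; the dropped squares are nonnegative by
`IsDARESolution.posDef`. -/
theorem IsDARESolution.le_sum_stageCost (hQ : Q.PosSemidef) (hR : R.PosDef)
    (h : IsDARESolution A B Q R P) (x : Fin n → ℝ) (u : ℕ → Fin m → ℝ) (T : ℕ) :
    x ⬝ᵥ (P *ᵥ x) - state A B x u T ⬝ᵥ (P *ᵥ state A B x u T) ≤
      ∑ t ∈ Finset.range T, stageCost Q R (state A B x u t) (u t) := by
  induction T with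
  | zero => simp [state]
  | succ T ih =>
    have h1 := h.quadForm (isSymm_of_isHermitian hR.isHermitian) (state A B x u T) (u T)
    have h2 := quadForm_nonneg (h.posDef hQ hR).posSemidef
      (u T - gain A B R P *ᵥ state A B x u T)
    rw [Finset.sum_range_succ, state, stageCost]
    linarith

theorem tendsto_quadForm_zero {k : ℕ} (S : Matrix (Fin k) (Fin k) ℝ) {f : ℕ → Fin k → ℝ}
    (hf : Tendsto f atTop (𝓝 0)) : Tendsto (fun t => f t ⬝ᵥ (S *ᵥ f t)) atTop (𝓝 0) := by
  have hc : Continuous fun x : Fin k → ℝ => x ⬝ᵥ (S *ᵥ x) :=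
    continuous_id.dotProduct (continuous_const.matrix_mulVec continuous_id)
  simpa [Function.comp_def] using (hc.tendsto 0).comp hf

/-- Every Riccati solution bounds the cost of stabilizing inputs from below. -/
theorem IsDARESolution.le_cost (hQ : Q.PosSemidef) (hR : R.PosDef)
    (h : IsDARESolution A B Q R P) {x : Fin n → ℝ} {u : ℕ → Fin m → ℝ}
    (hu : SteersToZero A B x u) : ENNReal.ofReal (x ⬝ᵥ (P *ᵥ x)) ≤ cost A B Q R x u := by
  rcases eq_or_ne (cost A B Q R x u) ⊤ with htop | htop
  · rw [htop]
    exact le_top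
  have hs := hasSum_stageCost hQ hR (lt_top_iff_ne_top.2 htop)
  have hlim := (tendsto_quadForm_zero P hu).const_sub (x ⬝ᵥ (P *ᵥ x))
  rw [sub_zero] at hlim
  have h1 := le_of_tendsto_of_tendsto' hlim hs.tendsto_sum_nat (h.le_sum_stageCost hQ hR x u)
  exact ENNReal.ofReal_le_of_le_toReal h1

theorem IsValueMatrix.isLargestDARESolution (hQ : Q.PosSemidef) (hR : R.PosDef)
    (h : IsValueMatrix A B Q R P) : IsLargestDARESolution A B Q R P := by
  refine ⟨h.isDARESolution hQ hR, fun P' h' => PosSemidef.of_dotProduct_mulVec_nonneg ?_ ?_⟩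
  · rw [Matrix.IsHermitian, conjTranspose_eq_transpose_of_trivial]
    exact h.1.sub h'.1
  · intro x
    obtain ⟨hn, u, hu, hc⟩ := h.2 x
    have h1 := h'.le_cost hQ hR hu.2.1
    rw [hc] at h1
    have h2 := (ENNReal.ofReal_le_ofReal_iff hn).1 h1
    rw [star_trivial, sub_mulVec, dotProduct_sub]
    linarith

/-! ### Optimal gains and Lyapunov equations. -/

variable {K : Matrix (Fin m) (Fin n) ℝ}

theorem IsLargestDARESolution.unique {P' : Matrix (Fin n) (Fin n) ℝ}
    (h : IsLargestDARESolution A B Q R P) (h' : IsLargestDARESolution A B Q R P') : P = P' := by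
  refine eq_of_quadForm_eq h.1.1 h'.1.1 fun x => ?_
  have h1 := quadForm_nonneg (h.2 P' h'.1) x
  have h2 := quadForm_nonneg (h'.2 P h.1) x
  rw [sub_mulVec, dotProduct_sub] at h1 h2
  linarith

theorem IsLargestDARESolution.isOptimalGain_iff (hL : LQRSolvable A B Q R)
    (h : IsLargestDARESolution A B Q R P) : IsOptimalGain A B Q R K ↔ K = gain A B R P := by
  constructor
  · rintro ⟨-, P', hP', rfl⟩
    rw [h.unique hP']
  · exact fun hK => ⟨hL, P, h, hK⟩

/-- An optimal gain is stabilizing, and its Riccati solution satisfies a Lyapunov equation. -/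
theorem IsOptimalGain.exists_lyapunov (hQ : Q.PosSemidef) (hR : R.PosDef)
    (h : IsOptimalGain A B Q R K) :
    (∀ x, Tendsto (fun t : ℕ => ((A + B * K) ^ t) *ᵥ x) atTop (𝓝 0)) ∧
      ∃ P : Matrix (Fin n) (Fin n) ℝ, P.IsSymm ∧
        (∀ x, x ⬝ᵥ (P *ᵥ x) = ((A + B * K) *ᵥ x) ⬝ᵥ (P *ᵥ ((A + B * K) *ᵥ x)) +
          (x ⬝ᵥ (Q *ᵥ x) + (K *ᵥ x) ⬝ᵥ (R *ᵥ (K *ᵥ x)))) ∧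
        R * K = -(Bᵀ * P * (A + B * K)) := by
  obtain ⟨hL, P, hP, rfl⟩ := h
  obtain ⟨P', hP'⟩ := hL.exists_isValueMatrix hQ hR
  -- The given `P` is thus the value matrix, whose closed loop generates the optimal trajectories.
  obtain rfl := hP.unique (hP'.isLargestDARESolution hQ hR)
  refine ⟨hP'.tendsto_pow hQ hR, P, hP.1.1, fun x => ?_, ?_⟩
  · have h1 := hP.1.quadForm (isSymm_of_isHermitian hR.isHermitian) x (gain A B R P *ᵥ x)
    rw [sub_self, zero_dotProduct, mulVec_mulVec x B, ← add_mulVec] at h1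
    linarith
  · have h1 := mul_gain (A := A) hP.1.2.1
    rw [Matrix.add_mul] at h1
    rw [Matrix.mul_add, ← Matrix.mul_assoc (Bᵀ * P) B, neg_add, ← h1]
    abel

/-- The form of `P - P'` is constant along trajectories of `M`, which tend to zero. -/
theorem lyapunov_unique {k : ℕ} {M P P' : Matrix (Fin k) (Fin k) ℝ} {g : (Fin k → ℝ) → ℝ}
    (hM : ∀ x, Tendsto (fun t : ℕ => (M ^ t) *ᵥ x) atTop (𝓝 0)) (hP : P.IsSymm) (hP' : P'.IsSymm)
    (h : ∀ x, x ⬝ᵥ (P *ᵥ x) = (M *ᵥ x) ⬝ᵥ (P *ᵥ (M *ᵥ x)) + g x)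
    (h' : ∀ x, x ⬝ᵥ (P' *ᵥ x) = (M *ᵥ x) ⬝ᵥ (P' *ᵥ (M *ᵥ x)) + g x) : P = P' := by
  refine eq_of_quadForm_eq hP hP' fun x => ?_
  have hc : ∀ t : ℕ, ((M ^ t) *ᵥ x) ⬝ᵥ ((P - P') *ᵥ ((M ^ t) *ᵥ x)) = x ⬝ᵥ ((P - P') *ᵥ x) := by
    intro t
    induction t with
    | zero => simp
    | succ t ih =>
      have e1 := h ((M ^ t) *ᵥ x)
      have e2 := h' ((M ^ t) *ᵥ x)
      rw [← ih, pow_succ', ← mulVec_mulVec]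
      simp only [sub_mulVec, dotProduct_sub]
      linarith
  have hlim := tendsto_quadForm_zero (P - P') (hM x)
  simp only [hc] at hlim
  have h0 := tendsto_nhds_unique hlim tendsto_const_nhds
  rw [sub_mulVec, dotProduct_sub] at h0
  linarith

/-- For a stable system with `QA = 0`, zero input is optimal. -/
theorem isValueMatrix_of_isStable (hQ : Q.PosSemidef) (hR : R.PosDef) (hA : IsStable A)
    (hQA : Q * A = 0) : IsValueMatrix A B Q R Q := by
  refine ⟨isSymm_of_isHermitian hQ.isHermitian, fun x => ⟨quadForm_nonneg hQ x, 0, ?_⟩⟩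
  -- From time one on the state lies in the range of `A`, where `Q` vanishes; only time zero costs
  -- anything.
  have hcost : cost A B Q R x (0 : ℕ → Fin m → ℝ) = ENNReal.ofReal (x ⬝ᵥ (Q *ᵥ x)) := by
    rw [cost_eq_add_succ]
    have h0 : cost A B Q R (A *ᵥ x + B *ᵥ (0 : ℕ → Fin m → ℝ) 0) (fun s => 0) = 0 := by
      rw [cost_eq_tsum, ENNReal.tsum_eq_zero]
      intro t
      have hs : state A B (A *ᵥ x + B *ᵥ (0 : ℕ → Fin m → ℝ) 0) (fun s => 0) t =
          A *ᵥ ((A ^ t) *ᵥ x) := by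
        have h1 := state_succ' (A := A) (B := B) x (0 : ℕ → Fin m → ℝ) t
        rw [state_zero_input, pow_succ', ← mulVec_mulVec] at h1
        exact h1.symm
      rw [hs, stageCost, mulVec_mulVec _ Q, hQA]
      simp
    have h1 : stageCost Q R x ((0 : ℕ → Fin m → ℝ) 0) = x ⬝ᵥ (Q *ᵥ x) := by
      simp [stageCost]
    rw [h1]
    exact (congrArg _ h0).trans (add_zero _)
  refine ⟨⟨?_, ?_, fun v _ => ?_⟩, hcost⟩
  · rw [hcost]
    exact ENNReal.ofReal_lt_top
  · exact (hA.tendsto_pow x).congr fun t => (state_zero_input x t).symm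
  · rw [hcost, cost_eq_add_succ]
    refine le_add_right (ENNReal.ofReal_le_ofReal ?_)
    exact le_add_of_nonneg_right (quadForm_nonneg hR.posSemidef _)

theorem IsValueMatrix.lqrSolvable (h : IsValueMatrix A B Q R P) : LQRSolvable A B Q R :=
  fun x => let ⟨u, hu, _⟩ := (h.2 x).2; ⟨u, hu⟩

theorem isOptimalGain_iff_of_isStable (hQ : Q.PosSemidef) (hR : R.PosDef) (hA : IsStable A)
    (hQA : Q * A = 0) : IsOptimalGain A B Q R K ↔ K = 0 := by
  have hV := isValueMatrix_of_isStable (B := B) hQ hR hA hQA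
  rw [(hV.isLargestDARESolution hQ hR).isOptimalGain_iff hV.lqrSolvable, gain, Matrix.mul_assoc,
    hQA, Matrix.mul_zero, neg_zero]

/-! ### Consistent systems sharing an optimal gain. -/

namespace InputStateData

variable {D : InputStateData n m}

theorem mem_consistentSystems {S : Matrix (Fin n) (Fin n) ℝ × Matrix (Fin n) (Fin m) ℝ} :
    S ∈ D.consistentSystems ↔ D.Xplus = S.1 * D.Xminus + S.2 * D.Uminus := by
  rw [consistentSystems, Set.mem_ofPred_eq, fromCols_mul_fromRows]

theorem GeneratedBy.mem_consistentSystems (hD : D.GeneratedBy A B) :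
    (A, B) ∈ D.consistentSystems := by
  rw [InputStateData.mem_consistentSystems]
  ext k j
  exact congrFun (hD j.1 j.2) k

/-- The consistent systems form an affine space whose direction is a left module over the
square matrices. -/
theorem add_mul_mem_consistentSystems
    {S S' : Matrix (Fin n) (Fin n) ℝ × Matrix (Fin n) (Fin m) ℝ}
    (h : S ∈ D.consistentSystems) (h' : S' ∈ D.consistentSystems) (F : Matrix (Fin n) (Fin n) ℝ) :
    (S.1 + F * (S'.1 - S.1), S.2 + F * (S'.2 - S.2)) ∈ D.consistentSystems := by
  rw [InputStateData.mem_consistentSystems] at *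
  have h0 : (S'.1 - S.1) * D.Xminus + (S'.2 - S.2) * D.Uminus = 0 := by
    rw [Matrix.sub_mul, Matrix.sub_mul, sub_add_sub_comm, ← h', ← h, sub_self]
  calc D.Xplus = S.1 * D.Xminus + S.2 * D.Uminus +
        F * ((S'.1 - S.1) * D.Xminus + (S'.2 - S.2) * D.Uminus) := by
        rw [h0, Matrix.mul_zero, add_zero, h]
    _ = _ := by
        rw [Matrix.mul_add, Matrix.add_mul, Matrix.add_mul, Matrix.mul_assoc, Matrix.mul_assoc]
        abel

/-- A common optimal gain yields the same closed loop for all consistent systems. -/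
theorem closedLoop_eq (hQ : Q.PosSemidef) (hR : R.PosDef)
    (hK : D.consistentSystems ⊆ systemsWithGain Q R K)
    {S S' : Matrix (Fin n) (Fin n) ℝ × Matrix (Fin n) (Fin m) ℝ}
    (h : S ∈ D.consistentSystems) (h' : S' ∈ D.consistentSystems) :
    S'.1 + S'.2 * K = S.1 + S.2 * K := by
  set M₀ := (S'.1 - S.1) + (S'.2 - S.2) * K with hM₀
  -- The multiplier `α • M₀ᵀ` turns the difference `M₀` into `α • (M₀ᵀ * M₀)`, whose trace detects
  -- `M₀`.
  have hstab : ∀ α : ℝ, IsStable ((S.1 + S.2 * K) + α • (M₀ᵀ * M₀)) := by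
    intro α
    have h1 := (IsOptimalGain.exists_lyapunov hQ hR
      (hK (add_mul_mem_consistentSystems h h' (α • M₀ᵀ)))).1
    have e : (S.1 + α • M₀ᵀ * (S'.1 - S.1)) + (S.2 + α • M₀ᵀ * (S'.2 - S.2)) * K =
        (S.1 + S.2 * K) + α • (M₀ᵀ * M₀) := by
      rw [hM₀, Matrix.add_mul, ← hM₀, ← Matrix.smul_mul]
      conv_rhs => rw [hM₀, Matrix.mul_add, ← hM₀, ← Matrix.mul_assoc]
      abel
    simp only [e] at h1
    exact isStable_of_tendsto_pow h1
  have h0 := trace_eq_zero_of_isStable_line hstab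
  rw [← conjTranspose_eq_transpose_of_trivial, trace_conjTranspose_mul_self_eq_zero_iff, hM₀,
    Matrix.sub_mul, sub_add_sub_comm] at h0
  exact sub_eq_zero.1 h0

theorem eq_zero_of_forall_transpose_mul_eq_zero {Z : Matrix (Fin n) (Fin n) ℝ} (hB : B ≠ 0)
    (h : ∀ F : Matrix (Fin n) (Fin n) ℝ, (F * B)ᵀ * Z = 0) : Z = 0 := by
  obtain ⟨i, j, hij⟩ : ∃ i j, B i j ≠ 0 := by
    by_contra! hc
    exact hB (Matrix.ext hc)
  ext k l
  -- The matrix unit moves row `i` of `B` to row `k`, so this entry of the product is `B i j * Z k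
  -- l`.
  have h1 := congrFun (congrFun (h (Matrix.single k i 1)) j) l
  rw [Matrix.mul_apply, Finset.sum_eq_single k] at h1
  · simpa [hij] using h1
  · intro b _ hb
    rw [transpose_apply, Matrix.single_mul_apply_of_ne _ _ _ _ _ hb, zero_mul]
  · simp

theorem stable_of_gain_of_ne (hQ : Q.PosSemidef) (hR : R.PosDef)
    (hK : D.consistentSystems ⊆ systemsWithGain Q R K)
    {S S' : Matrix (Fin n) (Fin n) ℝ × Matrix (Fin n) (Fin m) ℝ}
    (h : S ∈ D.consistentSystems) (h' : S' ∈ D.consistentSystems) (hne : S' ≠ S) :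
    (∀ T ∈ D.consistentSystems, T.1 = S.1) ∧ IsStable S.1 ∧ Q * S.1 = 0 := by
  have hcl := fun T hT => closedLoop_eq (S' := T) hQ hR hK h hT
  obtain ⟨hM, P, hP, hlyap, hRK⟩ := IsOptimalGain.exists_lyapunov hQ hR (hK h)
  -- With equal closed loops, equal `B` would force equal `A`.
  have hB : S'.2 - S.2 ≠ 0 := by
    intro h0
    have h2 := sub_eq_zero.1 h0
    have h3 := hcl S' h'
    rw [h2, add_left_inj] at h3
    exact hne (Prod.ext h3 h2)
  -- The perturbed system has the same closed loop, hence the same `P`; subtracting the two gain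
  -- equations leaves `(F * (S'.2 - S.2))ᵀ` times `P` times the closed loop.
  have hPM : P * (S.1 + S.2 * K) = 0 := by
    refine eq_zero_of_forall_transpose_mul_eq_zero hB fun F => ?_
    have hmem := add_mul_mem_consistentSystems h h' F
    obtain ⟨-, P', hP', hlyap', hRK'⟩ := IsOptimalGain.exists_lyapunov hQ hR (hK hmem)
    have hcl' := hcl _ hmem
    simp only at hcl' hlyap' hRK'
    rw [hcl'] at hRK'
    simp only [hcl'] at hlyap'
    obtain rfl := lyapunov_unique hM hP hP' hlyap hlyap'
    rw [hRK, neg_inj, transpose_add, Matrix.add_mul, Matrix.add_mul, left_eq_add] at hRK'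
    rw [← Matrix.mul_assoc, hRK']
  have hK0 : K = 0 := by
    rw [Matrix.mul_assoc, hPM, Matrix.mul_zero, neg_zero] at hRK
    have h1 := nonsing_inv_mul_cancel_left R K ((isUnit_iff_isUnit_det _).1 hR.isUnit)
    rw [← h1, hRK, Matrix.mul_zero]
  subst hK0
  simp only [Matrix.mul_zero, add_zero] at hM hPM hlyap hcl
  have hPQ : P = Q := by
    refine eq_of_quadForm_eq hP (isSymm_of_isHermitian hQ.isHermitian) fun x => ?_
    rw [hlyap x, mulVec_mulVec, hPM]
    simp
  exact ⟨hcl, isStable_of_tendsto_pow hM, hPQ ▸ hPM⟩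

theorem InformativeForIdentification.eq_singleton (h : D.InformativeForIdentification)
    (hD : D.GeneratedBy A B) : D.consistentSystems = {(A, B)} :=
  Set.eq_singleton_iff_unique_mem.2
    ⟨hD.mem_consistentSystems, fun _ hS => h.unique hS hD.mem_consistentSystems⟩

end InputStateData

end DataLQR

theorem mainTheorem5 (n m : ℕ)
    (Q : Matrix (Fin n) (Fin n) ℝ) (R : Matrix (Fin m) (Fin m) ℝ)
    (hQ : Q.PosSemidef) (hR : R.PosDef)
    (As : Matrix (Fin n) (Fin n) ℝ) (Bs : Matrix (Fin n) (Fin m) ℝ)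
    (D : DataLQR.InputStateData n m) (hD : D.GeneratedBy As Bs) :
    (D.InformativeForLQR Q R ↔
      (D.InformativeForIdentification ∧ DataLQR.LQRSolvable As Bs Q R) ∨
      ((∀ S ∈ D.consistentSystems, S.1 = As) ∧ DataLQR.IsStable As ∧ Q * As = 0)) ∧
    (D.InformativeForIdentification ∧ DataLQR.LQRSolvable As Bs Q R →
      D.consistentSystems = {(As, Bs)} ∧
      ∃ P : Matrix (Fin n) (Fin n) ℝ, DataLQR.IsLargestDARESolution As Bs Q R P ∧
        ∀ K : Matrix (Fin m) (Fin n) ℝ,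
          D.consistentSystems ⊆ DataLQR.systemsWithGain Q R K ↔
            K = -((R + Bsᵀ * P * Bs)⁻¹ * Bsᵀ * P * As)) ∧
    ((∀ S ∈ D.consistentSystems, S.1 = As) ∧ DataLQR.IsStable As ∧ Q * As = 0 →
      ∀ K : Matrix (Fin m) (Fin n) ℝ,
        D.consistentSystems ⊆ DataLQR.systemsWithGain Q R K ↔ K = 0) := by
  have hmem := hD.mem_consistentSystems
  have hident : D.InformativeForIdentification ∧ DataLQR.LQRSolvable As Bs Q R →
      D.consistentSystems = {(As, Bs)} ∧
      ∃ P : Matrix (Fin n) (Fin n) ℝ, DataLQR.IsLargestDARESolution As Bs Q R P ∧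
        ∀ K : Matrix (Fin m) (Fin n) ℝ,
          D.consistentSystems ⊆ DataLQR.systemsWithGain Q R K ↔
            K = -((R + Bsᵀ * P * Bs)⁻¹ * Bsᵀ * P * As) := by
    rintro ⟨hI, hL⟩
    have hS := hI.eq_singleton hD
    obtain ⟨P, hP⟩ := hL.exists_isValueMatrix hQ hR
    have hmax := hP.isLargestDARESolution hQ hR
    refine ⟨hS, P, hmax, fun K => ?_⟩
    rw [hS, Set.singleton_subset_iff]
    exact hmax.isOptimalGain_iff hL
  have hstab : (∀ S ∈ D.consistentSystems, S.1 = As) ∧ DataLQR.IsStable As ∧ Q * As = 0 →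
      ∀ K : Matrix (Fin m) (Fin n) ℝ,
        D.consistentSystems ⊆ DataLQR.systemsWithGain Q R K ↔ K = 0 := by
    rintro ⟨hA, hs, hQA⟩ K
    refine ⟨fun hK => (DataLQR.isOptimalGain_iff_of_isStable hQ hR hs hQA).1 (hK hmem), ?_⟩
    rintro hK ⟨A, B⟩ hS
    -- Only `B` varies, and the criterion for `K = 0` does not involve `B`.
    obtain rfl : A = As := hA _ hS
    exact (DataLQR.isOptimalGain_iff_of_isStable hQ hR hs hQA).2 hK
  refine ⟨⟨?_, ?_⟩, hident, hstab⟩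
  · rintro ⟨hL, K, hK⟩
    by_cases hI : ∀ S ∈ D.consistentSystems, S = (As, Bs)
    · exact Or.inl ⟨⟨_, hmem, hI⟩, hL _ hmem⟩
    · push Not at hI
      obtain ⟨S, hS, hne⟩ := hI
      exact Or.inr (DataLQR.InputStateData.stable_of_gain_of_ne hQ hR hK hmem hS hne)
  · intro h
    have hex : ∃ K, D.consistentSystems ⊆ DataLQR.systemsWithGain Q R K := by
      rcases h with h | h
      · obtain ⟨-, P, -, hK⟩ := hident h
        exact ⟨_, (hK _).2 rfl⟩
      · exact ⟨0, (hstab h 0).2 rfl⟩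
    obtain ⟨K, hK⟩ := hex
    exact ⟨fun S hS => (hK hS).1, K, hK⟩
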